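/- A KTB-algebra is an algebra $\mathbf A=\langle A;\vee,\wedge,\neg,\Diamond,0,1\rangle$ such that $\langle A;\vee,\wedge,\neg,0,1\rangle$ is a Boolean algebra and, with $\Box=\neg\Diamond\neg$, for all $x,y\in A$: $\Diamond 0=0$, $\Diamond(x\vee y)=\Diamond x\vee\Diamond y$, $x\le\Diamond x$ and $x\le\Box\Diamond x$. For $n\ge 1$, $\mathsf{Cm}(\mathbb K_n)$ denotes the complex algebra of the complete graph on $n$ vertices with a loop at every vertex, i.e. the Boolean algebra of all sets $X$ of vertices with $\Diamond X$ the set of vertices that are equal or adjacent to some vertex in $X$. $\mathrm{Var}(\mathbf A)=\mathrm{HSP}(\mathbf A)$ is the variety generated by $\mathbf A$. Let $\mathbf A$ be a KTB-algebra with the following properties: (i) $\mathbf A$ is infinite; (ii) $\mathsf{Cm}(\mathbb K_2)$ is isomorphic to a subalgebra of $\mathbf A$; (iii) every ultrapower of $\mathbf A$ is simple; (iv) every algebra $\mathbf B$ isomorphic to a subalgebra of an ultrapower of $\mathbf A$ satisfies $\mathbf B\cong\mathsf{Cm}(\mathbb K_1)$ or $\mathbf B\cong\mathsf{Cm}(\mathbb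 K_2)$, or has a subalgebra isomorphic to $\mathbf A$. Then $\mathrm{Var}(\mathbf A)$ has height $3$ in the lattice of all varieties of KTB-algebras ordered by inclusion (the longest strictly ascending chains of varieties ending in $\mathrm{Var}(\mathbf A)$ have exactly three steps; the variety of trivial algebras has height $0$), and $\mathrm{Var}(\mathbf A)$ covers $\mathrm{Var}(\mathsf{Cm}(\mathbb K_2))$ in this lattice. -/

import Mathlib

universe u v w

/-- A KTB-algebra: a Boolean algebra with a unary operation `dia` (written `◇`) such that
`◇0 = 0`, `◇(x ∨ y) = ◇x ∨ ◇y`, `x ≤ ◇x` and `x ≤ □◇x`, where `□ = ¬◇¬`. -/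
class KTBAlgebra (A : Type u) extends BooleanAlgebra A where
  dia : A → A
  dia_bot : dia ⊥ = ⊥
  dia_sup : ∀ x y : A, dia (x ⊔ y) = dia x ⊔ dia y
  le_dia : ∀ x : A, x ≤ dia x
  le_box_dia : ∀ x : A, x ≤ (dia (dia x)ᶜ)ᶜ

open KTBAlgebra (dia)

/-- Homomorphisms of KTB-algebras. -/
structure KTBHom (A : Type u) (B : Type v) [KTBAlgebra A] [KTBAlgebra B] where
  toFun : A → B
  map_sup : ∀ x y, toFun (x ⊔ y) = toFun x ⊔ toFun y
  map_inf : ∀ x y, toFun (x ⊓ y) = toFun x ⊓ toFun y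
  map_compl : ∀ x, toFun xᶜ = (toFun x)ᶜ
  map_bot : toFun ⊥ = ⊥
  map_top : toFun ⊤ = ⊤
  map_dia : ∀ x, toFun (dia x) = dia (toFun x)

namespace KTBHom

variable {A : Type u} {B : Type v} {C : Type w} [KTBAlgebra A] [KTBAlgebra B] [KTBAlgebra C]

instance : FunLike (KTBHom A B) A B where
  coe := toFun
  coe_injective f g h := by cases f; cases g; congr

@[simp] theorem sup (f : KTBHom A B) (x y : A) : f (x ⊔ y) = f x ⊔ f y := f.map_sup x y
@[simp] theorem inf (f : KTBHom A B) (x y : A) : f (x ⊓ y) = f x ⊓ f y := f.map_inf x y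
@[simp] theorem compl (f : KTBHom A B) (x : A) : f xᶜ = (f x)ᶜ := f.map_compl x
@[simp] theorem bot (f : KTBHom A B) : f ⊥ = ⊥ := f.map_bot
@[simp] theorem top (f : KTBHom A B) : f ⊤ = ⊤ := f.map_top
@[simp] theorem dia_apply (f : KTBHom A B) (x : A) : f (dia x) = dia (f x) := f.map_dia x

def id (A : Type u) [KTBAlgebra A] : KTBHom A A :=
  ⟨fun x => x, fun _ _ => rfl, fun _ _ => rfl, fun _ => rfl, rfl, rfl, fun _ => rfl⟩

def comp (g : KTBHom B C) (f : KTBHom A B) : KTBHom A C where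
  toFun x := g (f x)
  map_sup := by simp
  map_inf := by simp
  map_compl := by simp
  map_bot := by simp
  map_top := by simp
  map_dia := by simp

end KTBHom

/-- `B` embeds into `A`, i.e. `B` is isomorphic to a subalgebra of `A`. -/
def KTBEmbeds (B : Type u) (A : Type v) [KTBAlgebra B] [KTBAlgebra A] : Prop :=
  ∃ f : KTBHom B A, Function.Injective f

/-- `A` and `B` are isomorphic. -/
def KTBIsomorphic (A : Type u) (B : Type v) [KTBAlgebra A] [KTBAlgebra B] : Prop :=
  ∃ f : KTBHom A B, Function.Bijective f

/-- Congruences of a KTB-algebra. -/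
structure KTBCongruence (A : Type u) [KTBAlgebra A] extends Setoid A where
  sup : ∀ {x x' y y'}, r x x' → r y y' → r (x ⊔ y) (x' ⊔ y')
  inf : ∀ {x x' y y'}, r x x' → r y y' → r (x ⊓ y) (x' ⊓ y')
  compl : ∀ {x x'}, r x x' → r xᶜ x'ᶜ
  dia : ∀ {x x'}, r x x' → r (dia x) (dia x')

/-- A simple algebra: a non-trivial one whose only congruences are equality and the full relation. -/
def KTBIsSimple (A : Type u) [KTBAlgebra A] : Prop :=
  Nontrivial A ∧ ∀ θ : KTBCongruence A, (∀ x y, θ.r x y → x = y) ∨ (∀ x y, θ.r x y)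

/-! ### Complex algebras of graphs -/

/-- The universe of the complex algebra of a graph: all sets of vertices. -/
def Cm {V : Type u} (_ : SimpleGraph V) : Type u := Set V

/-- The complex algebra of the Kripke frame on `V` whose accessibility relation is the reflexive
closure of the adjacency relation of `G`. -/
instance Cm.instKTBAlgebra {V : Type u} (G : SimpleGraph V) : KTBAlgebra (Cm G) where
  toBooleanAlgebra := inferInstanceAs (BooleanAlgebra (Set V))
  dia X := {x : V | ∃ y : V, (x = y ∨ G.Adj x y) ∧ (show Set V from X) y}
  dia_bot := Set.eq_empty_of_forall_notMem fun _ ⟨_, _, h⟩ => h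
  dia_sup X Y := by
    refine Set.ext fun x => ⟨?_, ?_⟩
    · rintro ⟨y, h, hX | hY⟩
      exacts [Or.inl ⟨y, h, hX⟩, Or.inr ⟨y, h, hY⟩]
    · rintro (⟨y, h, hX⟩ | ⟨y, h, hY⟩)
      exacts [⟨y, h, Or.inl hX⟩, ⟨y, h, Or.inr hY⟩]
  le_dia X := fun x hx => ⟨x, Or.inl rfl, hx⟩
  le_box_dia X := by
    rintro x hx ⟨y, h, hy⟩
    exact hy ⟨x, h.imp Eq.symm (G.adj_symm ·), hx⟩

/-- `Cm(𝕂ₙ)`, the complex algebra of the (looped) complete graph on `n` vertices. The vertex set is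
lifted to the universe in which the algebras under consideration live. -/
abbrev CmK (n : ℕ) : Type u := Cm (⊤ : SimpleGraph (ULift.{u} (Fin n)))

/-! ### Ultrapowers -/

/-- The ultrapower `A^I / U`. -/
abbrev KTBUltrapower {I : Type v} (U : Ultrafilter I) (A : Type u) : Type (max v u) :=
  Filter.Germ (U : Filter I) A

/-- Operations of an ultrapower are computed coordinatewise on representatives. -/
instance KTBUltrapower.instKTBAlgebra {I : Type v} (U : Ultrafilter I) (A : Type u) [KTBAlgebra A] :
    KTBAlgebra (KTBUltrapower U A) where
  toDistribLattice := inferInstanceAs (DistribLattice (Filter.Germ (U : Filter I) A))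
  top := ((⊤ : A) : Filter.Germ (U : Filter I) A)
  bot := ((⊥ : A) : Filter.Germ (U : Filter I) A)
  compl := Filter.Germ.map (fun x => xᶜ)
  inf_compl_le_bot f := Filter.Germ.inductionOn f fun _ =>
    Filter.Eventually.of_forall fun _ => BooleanAlgebra.inf_compl_le_bot _
  top_le_sup_compl f := Filter.Germ.inductionOn f fun _ =>
    Filter.Eventually.of_forall fun _ => BooleanAlgebra.top_le_sup_compl _
  le_top f := Filter.Germ.inductionOn f fun _ => Filter.Eventually.of_forall fun _ => le_top
  bot_le f := Filter.Germ.inductionOn f fun _ => Filter.Eventually.of_forall fun _ => bot_le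
  sdiff f g := f ⊓ g.map (fun x => xᶜ)
  himp f g := g ⊔ f.map (fun x => xᶜ)
  sdiff_eq _ _ := rfl
  himp_eq _ _ := rfl
  dia := Filter.Germ.map dia
  dia_bot := congrArg (fun x : A => (x : Filter.Germ (U : Filter I) A)) KTBAlgebra.dia_bot
  dia_sup f g := Filter.Germ.inductionOn₂ f g fun _ _ => Filter.Germ.coe_eq.2 <|
    Filter.Eventually.of_forall fun _ => KTBAlgebra.dia_sup _ _
  le_dia f := Filter.Germ.inductionOn f fun _ =>
    Filter.Eventually.of_forall fun _ => KTBAlgebra.le_dia _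
  le_box_dia f := Filter.Germ.inductionOn f fun _ =>
    Filter.Eventually.of_forall fun _ => KTBAlgebra.le_box_dia _

/-! ### Direct products and subalgebras -/

/-- Direct products, with coordinatewise operations. -/
instance KTBAlgebra.instPi {I : Type v} (F : I → Type u) [∀ i, KTBAlgebra (F i)] :
    KTBAlgebra (∀ i, F i) where
  toBooleanAlgebra := inferInstanceAs (BooleanAlgebra (∀ i, F i))
  dia x := fun i => dia (x i)
  dia_bot := funext fun _ => KTBAlgebra.dia_bot
  dia_sup _ _ := funext fun _ => KTBAlgebra.dia_sup _ _
  le_dia _ := fun _ => KTBAlgebra.le_dia _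
  le_box_dia _ := fun _ => KTBAlgebra.le_box_dia _

/-- A subset closed under the operations is a KTB-algebra. -/
@[reducible] def KTBAlgebra.ofSubset {A : Type u} [KTBAlgebra A] (s : Set A)
    (hsup : ∀ x ∈ s, ∀ y ∈ s, x ⊔ y ∈ s) (hcompl : ∀ x ∈ s, xᶜ ∈ s) (hbot : ⊥ ∈ s)
    (hdia : ∀ x ∈ s, dia x ∈ s) : KTBAlgebra s :=
  have hinf : ∀ x ∈ s, ∀ y ∈ s, x ⊓ y ∈ s := fun x hx y hy => by
    simpa using hcompl _ (hsup _ (hcompl x hx) _ (hcompl y hy))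
  { toDistribLattice :=
      { sup := fun x y => ⟨x.1 ⊔ y.1, hsup _ x.2 _ y.2⟩
        inf := fun x y => ⟨x.1 ⊓ y.1, hinf _ x.2 _ y.2⟩
        le_sup_left := fun x y => (le_sup_left : x.1 ≤ x.1 ⊔ y.1)
        le_sup_right := fun x y => (le_sup_right : y.1 ≤ x.1 ⊔ y.1)
        sup_le := fun x y z (h : x.1 ≤ z.1) (h' : y.1 ≤ z.1) => (sup_le h h' : x.1 ⊔ y.1 ≤ z.1)
        inf_le_left := fun x y => (inf_le_left : x.1 ⊓ y.1 ≤ x.1)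
        inf_le_right := fun x y => (inf_le_right : x.1 ⊓ y.1 ≤ y.1)
        le_inf := fun x y z (h : x.1 ≤ y.1) (h' : x.1 ≤ z.1) => (le_inf h h' : x.1 ≤ y.1 ⊓ z.1)
        le_sup_inf := fun x y z =>
          (le_sup_inf : (x.1 ⊔ y.1) ⊓ (x.1 ⊔ z.1) ≤ x.1 ⊔ (y.1 ⊓ z.1)) }
    top := ⟨⊤, by simpa using hcompl _ hbot⟩
    bot := ⟨⊥, hbot⟩
    compl := fun x => ⟨x.1ᶜ, hcompl _ x.2⟩
    inf_compl_le_bot := fun x => (BooleanAlgebra.inf_compl_le_bot x.1 : x.1 ⊓ x.1ᶜ ≤ ⊥)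
    top_le_sup_compl := fun x => (BooleanAlgebra.top_le_sup_compl x.1 : ⊤ ≤ x.1 ⊔ x.1ᶜ)
    le_top := fun x => (le_top : x.1 ≤ ⊤)
    bot_le := fun x => (bot_le : ⊥ ≤ x.1)
    sdiff := fun x y => ⟨x.1 ⊓ y.1ᶜ, hinf _ x.2 _ (hcompl _ y.2)⟩
    himp := fun x y => ⟨y.1 ⊔ x.1ᶜ, hsup _ y.2 _ (hcompl _ x.2)⟩
    sdiff_eq := fun _ _ => rfl
    himp_eq := fun _ _ => rfl
    dia := fun x => ⟨dia x.1, hdia _ x.2⟩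
    dia_bot := Subtype.ext KTBAlgebra.dia_bot
    dia_sup := fun x y => Subtype.ext (KTBAlgebra.dia_sup x.1 y.1)
    le_dia := fun x => KTBAlgebra.le_dia x.1
    le_box_dia := fun x => KTBAlgebra.le_box_dia x.1 }

/-! ### Varieties -/

/-- Bundled KTB-algebras with universe in `Type u`. -/
structure KTBAlg : Type (u + 1) where
  carrier : Type u
  [str : KTBAlgebra carrier]

attribute [instance] KTBAlg.str

instance : CoeSort KTBAlg.{u} (Type u) := ⟨KTBAlg.carrier⟩

/-- `H(𝒞)`: homomorphic images of members of `𝒞`. -/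
def KTBAlg.H (C : Set KTBAlg.{u}) : Set KTBAlg.{u} :=
  {B | ∃ A ∈ C, ∃ f : KTBHom A B, Function.Surjective f}

/-- `S(𝒞)`: algebras isomorphic to subalgebras of members of `𝒞`. -/
def KTBAlg.S (C : Set KTBAlg.{u}) : Set KTBAlg.{u} :=
  {B | ∃ A ∈ C, KTBEmbeds B A}

/-- `P(𝒞)`: algebras isomorphic to direct products of families of members of `𝒞` (the empty family,
whose product is trivial, included). -/
def KTBAlg.P (C : Set KTBAlg.{u}) : Set KTBAlg.{u} :=
  {B | ∃ (I : Type u) (F : I → KTBAlg.{u}), (∀ i, F i ∈ C) ∧ KTBIsomorphic B (∀ i, F i)}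

/-- A variety of KTB-algebras: a class of KTB-algebras closed under homomorphic images,
subalgebras and direct products. -/
@[ext] structure KTBVariety : Type (u + 1) where
  mem : Set KTBAlg.{u}
  H_subset : KTBAlg.H mem ⊆ mem
  S_subset : KTBAlg.S mem ⊆ mem
  P_subset : KTBAlg.P mem ⊆ mem

/-- The poset `Subv(ℬ)` of varieties of KTB-algebras, ordered by inclusion. -/
instance : PartialOrder KTBVariety.{u} :=
  PartialOrder.lift KTBVariety.mem fun _ _ h => KTBVariety.ext h

namespace KTBAlg

theorem mem_HSP {C : Set KTBAlg.{u}} {B : KTBAlg.{u}} :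
    B ∈ H (S (P C)) ↔ ∃ (I : Type u) (F : I → KTBAlg.{u}) (A : KTBAlg.{u})
      (e : KTBHom A (∀ i, F i)) (q : KTBHom A B),
      (∀ i, F i ∈ C) ∧ Function.Injective e ∧ Function.Surjective q := by
  constructor
  · rintro ⟨A, ⟨D, ⟨I, F, hF, g, hg⟩, e, he⟩, q, hq⟩
    exact ⟨I, F, A, g.comp e, q, hF, hg.1.comp he, hq⟩
  · rintro ⟨I, F, A, e, q, hF, he, hq⟩
    exact ⟨A, ⟨⟨∀ i, F i⟩, ⟨I, F, hF, KTBHom.id _, Function.bijective_id⟩, e, he⟩, q, hq⟩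

theorem H_HSP (C : Set KTBAlg.{u}) : H (H (S (P C))) ⊆ H (S (P C)) := by
  rintro B ⟨A, ⟨D, hD, g, hg⟩, f, hf⟩
  exact ⟨D, hD, f.comp g, hf.comp hg⟩

theorem S_HSP (C : Set KTBAlg.{u}) : S (H (S (P C))) ⊆ H (S (P C)) := by
  rintro B ⟨A, ⟨D, ⟨E, hE, e, he⟩, q, hq⟩, f, hf⟩
  let s : Set D := {x | ∃ b : B, f b = q x}
  let _ : KTBAlgebra s := KTBAlgebra.ofSubset s
    (by rintro x ⟨a, ha⟩ y ⟨b, hb⟩; exact ⟨a ⊔ b, by simp [ha, hb]⟩)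
    (by rintro x ⟨a, ha⟩; exact ⟨aᶜ, by simp [ha]⟩)
    ⟨⊥, by simp⟩
    (by rintro x ⟨a, ha⟩; exact ⟨dia a, by simp [ha]⟩)
  let i : KTBHom s D :=
    ⟨Subtype.val, fun _ _ => rfl, fun _ _ => rfl, fun _ => rfl, rfl, rfl, fun _ => rfl⟩
  have key : ∀ x : s, f x.2.choose = q (i x) := fun x => x.2.choose_spec
  let p : KTBHom s B :=
    { toFun := fun x => x.2.choose
      map_sup := fun x y => hf (by rw [KTBHom.sup, key, key, key, i.sup, q.sup])
      map_inf := fun x y => hf (by rw [KTBHom.inf, key, key, key, i.inf, q.inf])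
      map_compl := fun x => hf (by rw [KTBHom.compl, key, key, i.compl, q.compl])
      map_bot := hf (by rw [KTBHom.bot, key, i.bot, q.bot])
      map_top := hf (by rw [KTBHom.top, key, i.top, q.top])
      map_dia := fun x => hf (by rw [KTBHom.dia_apply, key, key, i.dia_apply, q.dia_apply]) }
  refine ⟨⟨s⟩, ⟨E, hE, e.comp i, he.comp Subtype.val_injective⟩, p, fun b => ?_⟩
  obtain ⟨x, hx⟩ := hq (f b)
  exact ⟨⟨x, b, hx.symm⟩, hf ((key ⟨x, b, hx.symm⟩).trans hx)⟩

theorem P_HSP (C : Set KTBAlg.{u}) : P (H (S (P C))) ⊆ H (S (P C)) := by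
  rintro B ⟨J, G, hG, g, hg⟩
  simp only [mem_HSP] at hG
  choose I F A e q hF he hq using hG
  have : ∃ h : KTBHom (∀ j, G j) B, Function.Surjective h := by
    let E := Equiv.ofBijective g hg
    have hE : ∀ x, g (E.symm x) = x := E.apply_symm_apply
    refine ⟨⟨E.symm, ?_, ?_, ?_, ?_, ?_, ?_⟩, E.symm.surjective⟩ <;> intros <;> apply hg.1 <;>
      simp [hE]
  obtain ⟨h, hh⟩ := this
  rw [mem_HSP]
  refine ⟨Σ j, I j, fun k => F k.1 k.2, ⟨∀ j, A j⟩,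
    ⟨fun x k => e k.1 (x k.1) k.2, ?_, ?_, ?_, ?_, ?_, ?_⟩,
    h.comp ⟨fun x j => q j (x j), ?_, ?_, ?_, ?_, ?_, ?_⟩, fun k => hF k.1 k.2, ?_, hh.comp ?_⟩
  · exact fun x y => funext fun k => congrFun ((e k.1).sup (x k.1) (y k.1)) k.2
  · exact fun x y => funext fun k => congrFun ((e k.1).inf (x k.1) (y k.1)) k.2
  · exact fun x => funext fun k => congrFun ((e k.1).compl (x k.1)) k.2
  · exact funext fun k => congrFun (e k.1).bot k.2
  · exact funext fun k => congrFun (e k.1).top k.2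
  · exact fun x => funext fun k => congrFun ((e k.1).dia_apply (x k.1)) k.2
  · exact fun x y => funext fun j => (q j).sup (x j) (y j)
  · exact fun x y => funext fun j => (q j).inf (x j) (y j)
  · exact fun x => funext fun j => (q j).compl (x j)
  · exact funext fun j => (q j).bot
  · exact funext fun j => (q j).top
  · exact fun x => funext fun j => (q j).dia_apply (x j)
  · intro x y hxy
    exact funext fun j => he j (funext fun i => congrFun hxy ⟨j, i⟩)
  · intro y
    choose x hx using fun j => hq j (y j)
    exact ⟨x, funext hx⟩

end KTBAlg

/-- `Var(𝒞) = HSP(𝒞)`, the variety generated by a class of KTB-algebras. -/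
def KTBVariety.gen (C : Set KTBAlg.{u}) : KTBVariety.{u} where
  mem := KTBAlg.H (KTBAlg.S (KTBAlg.P C))
  H_subset := KTBAlg.H_HSP C
  S_subset := KTBAlg.S_HSP C
  P_subset := KTBAlg.P_HSP C

/-- `Var(A)`, the variety generated by a single KTB-algebra. -/
def KTBVariety.Var (A : Type u) [KTBAlgebra A] : KTBVariety.{u} :=
  KTBVariety.gen {⟨A⟩}

/-! The point is that the proper subvarieties of $\mathrm{Var}(\mathbf A)$ form a chain. Since
ultrapowers of $\mathbf A$ are simple, a compactness argument gives one $n$ with $\Diamond^n x=1$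
for all $x\neq 0$ in $\mathbf A$ (`exists_uniform_iterate_dia`). The term $\Diamond^n$ then tells
zero from nonzero, and a Jónsson-style argument separates the points of any member of
$\mathrm{Var}(\mathbf A)$ by homomorphisms into ultrapowers of $\mathbf A$
(`exists_hom_ultrapower`).

By (iv), the image of such a homomorphism is $\mathsf{Cm}(\mathbb K_1)$, $\mathsf{Cm}(\mathbb K_2)$,
or contains a copy of $\mathbf A$. A subvariety without $\mathbf A$ therefore has all its members
separated by maps to $\mathsf{Cm}(\mathbb K_2)$, so it lies in $\mathrm{Var}(\mathsf{Cm}(\mathbb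
K_2))$. The same reasoning applies one and two levels further down. The steps are strict because of
nontriviality, the identity $\Diamond x=x$, and the infinitude of $\mathbf A$ (`notMem_Var_two`). -/

namespace KTBAlgebra

/-! ### Iterates of ◇ and principal congruences -/

theorem dia_mono {A : Type u} [KTBAlgebra A] : Monotone (dia : A → A) := fun x y h => by
  rw [← sup_eq_right.2 h, dia_sup]
  exact le_sup_left

theorem dia_top {A : Type u} [KTBAlgebra A] : dia (⊤ : A) = ⊤ :=
  top_le_iff.1 (le_dia ⊤)

theorem iterate_dia_bot {A : Type u} [KTBAlgebra A] (n : ℕ) : dia^[n] (⊥ : A) = ⊥ :=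
  Function.iterate_fixed dia_bot n

theorem iterate_dia_le_of_le {A : Type u} [KTBAlgebra A] {m n : ℕ} (h : m ≤ n) (x : A) :
    dia^[m] x ≤ dia^[n] x :=
  Function.monotone_iterate_of_id_le (fun y => le_dia y) h x

theorem le_iterate_dia {A : Type u} [KTBAlgebra A] (n : ℕ) (x : A) : x ≤ dia^[n] x :=
  iterate_dia_le_of_le (Nat.zero_le n) x

/-- The principal congruence that collapses `x` to `⊥`. -/
def principalCongruence {A : Type u} [KTBAlgebra A] (x : A) : KTBCongruence A where
  -- The iterates of ◇ on `x` increase, so the elements below one of them form a ◇-closed ideal. Two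
  -- elements are related when their symmetric difference lies in it.
  r y z := ∃ n, y ≤ z ⊔ dia^[n] x ∧ z ≤ y ⊔ dia^[n] x
  iseqv :=
    { refl := fun y => ⟨0, le_sup_left, le_sup_left⟩
      symm := fun ⟨n, h, h'⟩ => ⟨n, h', h⟩
      trans := by
        rintro a b c ⟨m, h₁, h₂⟩ ⟨n, h₃, h₄⟩
        have hm := iterate_dia_le_of_le (le_max_left m n) x
        have hn := iterate_dia_le_of_le (le_max_right m n) x
        refine ⟨max m n, ?_, ?_⟩
        · exact h₁.trans (sup_le (h₃.trans (sup_le_sup_left hn _)) (hm.trans le_sup_right))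
        · exact h₄.trans (sup_le (h₂.trans (sup_le_sup_left hm _)) (hn.trans le_sup_right)) }
  sup := by
    rintro a a' b b' ⟨m, h₁, h₂⟩ ⟨n, h₃, h₄⟩
    have hm := iterate_dia_le_of_le (le_max_left m n) x
    have hn := iterate_dia_le_of_le (le_max_right m n) x
    refine ⟨max m n, sup_le ?_ ?_, sup_le ?_ ?_⟩
    · exact h₁.trans (sup_le_sup le_sup_left hm)
    · exact h₃.trans (sup_le_sup le_sup_right hn)
    · exact h₂.trans (sup_le_sup le_sup_left hm)
    · exact h₄.trans (sup_le_sup le_sup_right hn)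
  inf := by
    rintro a a' b b' ⟨m, h₁, h₂⟩ ⟨n, h₃, h₄⟩
    have hm := iterate_dia_le_of_le (le_max_left m n) x
    have hn := iterate_dia_le_of_le (le_max_right m n) x
    refine ⟨max m n, ?_, ?_⟩ <;> rw [sup_inf_right]
    · exact inf_le_inf (h₁.trans (sup_le_sup_left hm _)) (h₃.trans (sup_le_sup_left hn _))
    · exact inf_le_inf (h₂.trans (sup_le_sup_left hm _)) (h₄.trans (sup_le_sup_left hn _))
  compl := by
    have key : ∀ {a b c : A}, a ≤ b ⊔ c → bᶜ ≤ aᶜ ⊔ c := fun {a b c} h => by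
      rw [← compl_le_compl_iff_le, compl_sup, compl_compl, compl_compl, ← sdiff_eq]
      exact sdiff_le_iff.2 (by rwa [sup_comm])
    rintro a a' ⟨n, h₁, h₂⟩
    exact ⟨n, key h₂, key h₁⟩
  dia := by
    rintro a a' ⟨n, h₁, h₂⟩
    refine ⟨n + 1, ?_, ?_⟩ <;> rw [Function.iterate_succ_apply', ← dia_sup]
    exacts [dia_mono h₁, dia_mono h₂]

/-- The principal congruence of `x` identifies `x` with `⊥`, so it is not equality. By simplicity it
identifies `⊥` with `⊤`, which puts `⊤` below some iterate. -/
theorem exists_iterate_dia_eq_top {A : Type u} [KTBAlgebra A] (hA : KTBIsSimple A) {x : A}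
    (hx : x ≠ ⊥) : ∃ n, dia^[n] x = ⊤ := by
  rcases hA.2 (principalCongruence x) with h | h
  · exact absurd (h x ⊥ ⟨0, le_sup_right, bot_le⟩) hx
  · obtain ⟨n, -, hn⟩ := h ⊥ ⊤
    exact ⟨n, by simpa using hn⟩

end KTBAlgebra

open KTBAlgebra

/-! ### Ultrapowers and the uniform bound -/

namespace KTBUltrapower

theorem coe_iterate_dia {I : Type v} (U : Ultrafilter I) {A : Type u} [KTBAlgebra A] (n : ℕ)
    (f : I → A) :
    dia^[n] ((f : Filter.Germ (U : Filter I) A) : KTBUltrapower U A) =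
      ((fun i => dia^[n] (f i) : I → A) : Filter.Germ (U : Filter I) A) := by
  induction n generalizing f with
  | zero => rfl
  | succ n ih => exact ih fun i => dia (f i)

/-- The canonical projection of a power onto an ultrapower. -/
def proj {I : Type v} (U : Ultrafilter I) (A : Type u) [KTBAlgebra A] :
    KTBHom (I → A) (KTBUltrapower U A) where
  toFun f := (f : Filter.Germ (U : Filter I) A)
  map_sup _ _ := rfl
  map_inf _ _ := rfl
  map_compl _ := rfl
  map_bot := rfl
  map_top := rfl
  map_dia _ := rfl

theorem proj_eq_iff {I : Type v} {U : Ultrafilter I} {A : Type u} [KTBAlgebra A] {f g : I → A} :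
    proj U A f = proj U A g ↔ ∀ᶠ i in (U : Filter I), f i = g i :=
  Filter.Germ.coe_eq

end KTBUltrapower

/-- If all ultrapowers are simple, the number of steps needed to reach `⊤` is bounded. -/
theorem KTBAlgebra.exists_uniform_iterate_dia {A : Type u} [KTBAlgebra A]
    (simple : ∀ (I : Type u) (U : Ultrafilter I), KTBIsSimple (KTBUltrapower U A)) :
    ∃ n, ∀ x : A, x ≠ ⊥ → dia^[n] x = ⊤ := by
  by_contra! h
  choose x hx hx' using h
  -- The sequence of counterexamples is nonzero in a nonprincipal ultrapower, so a fixed `n` sends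
  -- it to `⊤` on a set of `U`. That set contains some `i ≥ n`, and there the `i`-th counterexample
  -- reaches `⊤` within `i` steps.
  let U : Ultrafilter (ULift.{u} ℕ) := Filter.hyperfilter _
  have hne : KTBUltrapower.proj U A (fun i => x i.down) ≠ ⊥ := by
    intro h0
    rw [← (KTBUltrapower.proj U A).bot, KTBUltrapower.proj_eq_iff] at h0
    obtain ⟨i, hi⟩ := h0.exists
    exact hx _ hi
  obtain ⟨n, hn⟩ := exists_iterate_dia_eq_top (simple _ U) hne
  have hn' : ∀ᶠ i in (U : Filter (ULift.{u} ℕ)), dia^[n] (x i.down) = ⊤ :=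
    Filter.Germ.coe_eq.1 ((KTBUltrapower.coe_iterate_dia U n fun i => x i.down).symm.trans hn)
  have hfin : {i : ULift.{u} ℕ | i.down < n}.Finite :=
    (Set.finite_lt_nat n).preimage ULift.down_injective.injOn
  obtain ⟨i, hi, hi'⟩ := (hn'.and (Filter.compl_mem_hyperfilter_of_finite hfin)).exists
  exact hx' i.down (top_le_iff.1 (hi ▸ iterate_dia_le_of_le (not_lt.1 hi') _))

/-! ### Factorisation and images of homomorphisms -/

namespace KTBHom

theorem iterate_dia_apply {A : Type u} {B : Type v} [KTBAlgebra A] [KTBAlgebra B] (f : KTBHom A B)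
    (n : ℕ) (x : A) : f (dia^[n] x) = dia^[n] (f x) :=
  Function.Semiconj.iterate_right (f := f) f.dia_apply n x

/-- Evaluation of a product at a coordinate. -/
def eval {I : Type v} (F : I → Type u) [∀ i, KTBAlgebra (F i)] (i : I) :
    KTBHom (∀ i, F i) (F i) :=
  ⟨fun x => x i, fun _ _ => rfl, fun _ _ => rfl, fun _ => rfl, rfl, rfl, fun _ => rfl⟩

/-- The homomorphism into a product with given coordinates. -/
def pi {B : Type w} [KTBAlgebra B] {I : Type v} {F : I → Type u} [∀ i, KTBAlgebra (F i)]
    (f : ∀ i, KTBHom B (F i)) : KTBHom B (∀ i, F i) where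
  toFun x i := f i x
  map_sup x y := funext fun i => (f i).sup x y
  map_inf x y := funext fun i => (f i).inf x y
  map_compl x := funext fun i => (f i).compl x
  map_bot := funext fun i => (f i).bot
  map_top := funext fun i => (f i).top
  map_dia x := funext fun i => (f i).dia_apply x

/-- A homomorphism constant on the fibres of a surjective homomorphism factors through it. -/
theorem exists_factor {D : Type u} {B : Type v} {C : Type w} [KTBAlgebra D] [KTBAlgebra B]
    [KTBAlgebra C] (q : KTBHom D B) (hq : Function.Surjective q) (h : KTBHom D C)
    (hqh : ∀ a b, q a = q b → h a = h b) : ∃ f : KTBHom B C, ∀ d, f (q d) = h d := by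
  choose s hs using hq
  have key : ∀ x d, q d = x → h (s x) = h d := fun x d hd => hqh _ _ (by rw [hs, hd])
  refine ⟨⟨fun x => h (s x), fun x y => ?_, fun x y => ?_, fun x => ?_, ?_, ?_, fun x => ?_⟩,
    fun d => key _ _ rfl⟩
  · rw [← h.sup]; exact key _ _ (by simp [hs])
  · rw [← h.inf]; exact key _ _ (by simp [hs])
  · rw [← h.compl]; exact key _ _ (by simp [hs])
  · rw [← h.bot]; exact key _ _ (by simp)
  · rw [← h.top]; exact key _ _ (by simp)
  · rw [← h.dia_apply]; exact key _ _ (by simp [hs])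

/-- The injection makes (iv) applicable to the image, while the surjection keeps the image in every
variety containing `B`. -/
theorem exists_image {B : Type v} {C : Type u} [KTBAlgebra B] [KTBAlgebra C] (f : KTBHom B C) :
    ∃ (S : Type u) (_ : KTBAlgebra S) (p : KTBHom B S) (i : KTBHom S C),
      Function.Surjective p ∧ Function.Injective i ∧ ∀ x, i (p x) = f x := by
  let _ : KTBAlgebra (Set.range f) := KTBAlgebra.ofSubset (Set.range f)
    (by rintro _ ⟨a, rfl⟩ _ ⟨b, rfl⟩; exact ⟨a ⊔ b, f.sup a b⟩)
    (by rintro _ ⟨a, rfl⟩; exact ⟨aᶜ, f.compl a⟩)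
    ⟨⊥, f.bot⟩
    (by rintro _ ⟨a, rfl⟩; exact ⟨dia a, f.dia_apply a⟩)
  refine ⟨Set.range f, inferInstance,
    ⟨Set.rangeFactorization f, fun x y => Subtype.ext (f.sup x y),
      fun x y => Subtype.ext (f.inf x y), fun x => Subtype.ext (f.compl x),
      Subtype.ext f.bot, Subtype.ext f.top, fun x => Subtype.ext (f.dia_apply x)⟩,
    ⟨Subtype.val, fun _ _ => rfl, fun _ _ => rfl, fun _ => rfl, rfl, rfl, fun _ => rfl⟩,
    Set.rangeFactorization_surjective, Subtype.val_injective, fun _ => rfl⟩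

/-- If `f x = f y`, then `f` kills `x ⊓ yᶜ`, which gives `x ≤ y`; the other inequality is symmetric.
-/
theorem injective_of_eq_bot {A : Type u} {B : Type v} [KTBAlgebra A] [KTBAlgebra B]
    (f : KTBHom A B) (hf : ∀ x, f x = ⊥ → x = ⊥) : Function.Injective f := by
  have key : ∀ x y, f x = f y → x ≤ y := fun x y h => by
    have := hf (x ⊓ yᶜ) (by simp [h])
    exact le_compl_iff_disjoint_right.2 (disjoint_iff.2 this) |>.trans_eq (compl_compl y)
  exact fun x y h => le_antisymm (key x y h) (key y x h.symm)

end KTBHom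

/-! ### Membership in generated varieties and separation by ultrapowers -/

namespace KTBVariety

theorem mem_of_surjective (V : KTBVariety.{u}) {A B : Type u} [KTBAlgebra A] [KTBAlgebra B]
    (hA : (⟨A⟩ : KTBAlg) ∈ V.mem) (f : KTBHom A B) (hf : Function.Surjective f) :
    (⟨B⟩ : KTBAlg) ∈ V.mem :=
  V.H_subset ⟨_, hA, f, hf⟩

theorem mem_of_embeds (V : KTBVariety.{u}) {A B : Type u} [KTBAlgebra A] [KTBAlgebra B]
    (hA : (⟨A⟩ : KTBAlg) ∈ V.mem) (h : KTBEmbeds B A) : (⟨B⟩ : KTBAlg) ∈ V.mem :=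
  V.S_subset ⟨_, hA, h⟩

theorem mem_pi (V : KTBVariety.{u}) {I : Type u} (F : I → KTBAlg.{u}) (hF : ∀ i, F i ∈ V.mem) :
    (⟨∀ i, F i⟩ : KTBAlg) ∈ V.mem :=
  V.P_subset ⟨I, F, hF, KTBHom.id _, Function.bijective_id⟩

theorem mem_of_subsingleton (V : KTBVariety.{u}) (B : KTBAlg.{u}) [Subsingleton B] :
    B ∈ V.mem := by
  refine V.P_subset ⟨PEmpty, fun i => i.elim, fun i => i.elim, KTBHom.pi fun i => i.elim, ?_, ?_⟩
  · exact fun x y _ => Subsingleton.elim x y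
  · exact fun y => ⟨⊥, funext fun i => i.elim⟩

theorem Var_le_iff {A : Type u} [KTBAlgebra A] {V : KTBVariety.{u}} :
    Var A ≤ V ↔ (⟨A⟩ : KTBAlg) ∈ V.mem := by
  constructor
  · intro h
    refine h (KTBAlg.mem_HSP.2 ⟨PUnit, fun _ => ⟨A⟩, ⟨A⟩, KTBHom.pi fun _ => KTBHom.id A,
      KTBHom.id A, fun _ => rfl, ?_, Function.surjective_id⟩)
    exact fun x y hxy => congrFun hxy PUnit.unit
  · rintro h B hB
    obtain ⟨I, F, D, e, q, hF, he, hq⟩ := KTBAlg.mem_HSP.1 hB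
    have hF' : ∀ i, F i ∈ V.mem := fun i => (hF i : F i = ⟨A⟩) ▸ h
    exact V.mem_of_surjective (V.mem_of_embeds (V.mem_pi F hF') ⟨e, he⟩) q hq

theorem self_mem_Var (A : Type u) [KTBAlgebra A] : (⟨A⟩ : KTBAlg) ∈ (Var A).mem :=
  Var_le_iff.1 le_rfl

theorem mem_Var_iff {A B : Type u} [KTBAlgebra A] [KTBAlgebra B] :
    (⟨B⟩ : KTBAlg) ∈ (Var A).mem ↔ ∃ (I D : Type u) (_ : KTBAlgebra D) (e : KTBHom D (I → A))
      (q : KTBHom D B), Function.Injective e ∧ Function.Surjective q := by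
  refine KTBAlg.mem_HSP.trans ⟨?_, ?_⟩
  · rintro ⟨I, F, D, e, q, hF, he, hq⟩
    obtain rfl : F = fun _ => ⟨A⟩ := funext hF
    exact ⟨I, D, inferInstance, e, q, he, hq⟩
  · rintro ⟨I, D, _, e, q, he, hq⟩
    exact ⟨I, fun _ => ⟨A⟩, ⟨D⟩, e, q, fun _ => rfl, he, hq⟩

/-- Identities in two variables, given as equations between natural binary operations, pass from an
algebra to the variety it generates. -/
theorem identity_of_mem_Var {A B : Type u} [KTBAlgebra A] [KTBAlgebra B]
    (hB : (⟨B⟩ : KTBAlg) ∈ (Var A).mem)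
    (s t : ∀ (X : Type u) [KTBAlgebra X], X → X → X)
    (hs : ∀ (X Y : Type u) [KTBAlgebra X] [KTBAlgebra Y] (f : KTBHom X Y) (x y : X),
      f (s X x y) = s Y (f x) (f y))
    (ht : ∀ (X Y : Type u) [KTBAlgebra X] [KTBAlgebra Y] (f : KTBHom X Y) (x y : X),
      f (t X x y) = t Y (f x) (f y))
    (h : ∀ x y : A, s A x y = t A x y) (x y : B) : s B x y = t B x y := by
  obtain ⟨I, D, _, e, q, he, hq⟩ := mem_Var_iff.1 hB
  obtain ⟨a, rfl⟩ := hq x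
  obtain ⟨b, rfl⟩ := hq y
  rw [← hs, ← ht]
  refine congrArg q (he (funext fun i => ?_))
  rw [hs, ht]
  exact (hs _ _ (KTBHom.eval (fun _ : I => A) i) (e a) (e b)).trans
    ((h _ _).trans (ht _ _ (KTBHom.eval (fun _ : I => A) i) (e a) (e b)).symm)

/-- If every nonzero element of every member of `V` is kept nonzero by some homomorphism to `C`,
then `V ≤ Var C`. -/
theorem le_Var_of_separating {V : KTBVariety.{u}} {C : Type u} [KTBAlgebra C]
    (h : ∀ (B : Type u) [KTBAlgebra B], (⟨B⟩ : KTBAlg) ∈ V.mem →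
      ∀ b : B, b ≠ ⊥ → ∃ f : KTBHom B C, f b ≠ ⊥) : V ≤ Var C := by
  rintro ⟨B⟩ hB
  choose f hf using h B hB
  refine mem_Var_iff.2 ⟨{b : B // b ≠ ⊥}, B, inferInstance, KTBHom.pi fun b => f b.1 b.2,
    KTBHom.id B, KTBHom.injective_of_eq_bot _ fun x hx => ?_, Function.surjective_id⟩
  by_contra hne
  exact hf x hne (congrFun hx ⟨x, hne⟩)

/-- Under a uniform bound on the number of steps to reach `⊤`, the members of `Var A` are separated
by homomorphisms into ultrapowers of `A`. -/
theorem exists_hom_ultrapower {A : Type u} [KTBAlgebra A] {n : ℕ}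
    (hn : ∀ x : A, x ≠ ⊥ → dia^[n] x = ⊤) {B : Type u} [KTBAlgebra B]
    (hB : (⟨B⟩ : KTBAlg) ∈ (Var A).mem) {b : B} (hb : b ≠ ⊥) :
    ∃ (I : Type u) (U : Ultrafilter I) (f : KTBHom B (KTBUltrapower U A)), f b ≠ ⊥ := by
  have hA : ∀ x : A, dia^[n] (dia x) = dia^[n] x := fun x => by
    rcases eq_or_ne x ⊥ with rfl | hx
    · rw [dia_bot]
    · rw [← Function.iterate_succ_apply, Function.iterate_succ_apply', hn x hx, dia_top]
  have hstep : ∀ x : B, dia^[n] (dia x) = dia^[n] x := fun x =>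
    identity_of_mem_Var hB (fun X _ x _ => dia^[n] (dia x)) (fun X _ x _ => dia^[n] x)
      (fun X Y _ _ f x _ => by simp [f.iterate_dia_apply])
      (fun X Y _ _ f x _ => by simp [f.iterate_dia_apply]) (fun x _ => hA x) x x
  have hiter : ∀ (m : ℕ) (x : B), dia^[n] (dia^[m] x) = dia^[n] x := fun m => by
    induction m with
    | zero => exact fun x => rfl
    | succ m ih => exact fun x => by rw [Function.iterate_succ_apply, ih, hstep]
  obtain ⟨I, D, _, e, q, he, hq⟩ := mem_Var_iff.1 hB
  -- a prime ideal of `B` that avoids `b`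
  obtain ⟨W, hWp, hbW⟩ : ∃ W : Order.Ideal B, W.IsPrime ∧ b ∉ W := by
    have hd : Disjoint ((Order.PFilter.principal b : Order.PFilter B) : Set B)
        ((Order.Ideal.principal ⊥ : Order.Ideal B) : Set B) := by
      rw [Set.disjoint_left]
      intro x hx hx'
      have hx'' : x = ⊥ := le_bot_iff.1 (Order.Ideal.mem_principal.1 hx')
      subst hx''
      exact hb (le_bot_iff.1 (by simpa using hx))
    obtain ⟨W, hW, -, hWd⟩ := DistribLattice.prime_ideal_of_disjoint_filter_ideal hd
    exact ⟨W, hW, fun h => Set.disjoint_left.1 hWd (by simp) h⟩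
  -- `P` is contained in `W`, and by `hstep` it is closed under ◇. It is to be the kernel of the map
  -- from `B` to the ultrapower. `hPinf` is the form of primeness inherited from `W`.
  let P : Set B := {x | dia^[n] x ∈ W}
  have hPinf : ∀ x y : B, x ∉ P → y ∉ P → dia^[n] x ⊓ dia^[n] y ∉ P := fun x y hx hy h => by
    rcases hWp.mem_or_mem (W.lower (le_iterate_dia n _) h) with h | h
    exacts [hx h, hy h]
  -- `F` collects the sets of coordinates large enough that vanishing there forces `q d` into `P`.
  -- An ultrafilter contained in `F` is sought.
  let F : Set (Set I) := {J | ∀ d : D, (∀ i ∈ J, e d i = ⊥) → q d ∈ P}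
  have hFunion : ∀ J K, J ∉ F → K ∉ F → J ∪ K ∉ F := by
    intro J K hJ hK h
    simp only [F, Set.mem_ofPred_eq, not_forall] at hJ hK
    obtain ⟨x, hxJ, hx⟩ := hJ
    obtain ⟨y, hyK, hy⟩ := hK
    have hev : ∀ (d : D) (i : I), e d i = ⊥ → e (dia^[n] d) i = ⊥ := fun d i hd => by
      have : e (dia^[n] d) i = dia^[n] (e d i) := by
        rw [e.iterate_dia_apply]
        exact (KTBHom.eval (fun _ : I => A) i).iterate_dia_apply n (e d)
      rw [this, hd, iterate_dia_bot]
    -- If `x` vanishes on `J` and `y` on `K`, the meet of their `n`-th iterates vanishes on `J ∪ K`,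
    -- while its image under `q` avoids `P`.
    refine hPinf _ _ hx hy ?_
    rw [← q.iterate_dia_apply, ← q.iterate_dia_apply, ← q.inf]
    refine h _ fun i hi => ?_
    rw [e.inf]
    change e _ i ⊓ e _ i = ⊥
    rcases hi with hi | hi
    · rw [hev x i (hxJ i hi), bot_inf_eq]
    · rw [hev y i (hyK i hi), inf_bot_eq]
  have hFmono : ∀ J K : Set I, J ⊆ K → J ∈ F → K ∈ F := fun J K hJK hJ d hd =>
    hJ d fun i hi => hd i (hJK hi)
  have huniv : Set.univ ∈ F := fun d hd => by
    have : d = ⊥ := he (funext fun i => (hd i trivial).trans (by rw [e.bot]; rfl))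
    change dia^[n] (q d) ∈ W
    rw [this, q.bot, iterate_dia_bot]
    exact W.bot_mem
  have hempty : ∅ ∉ F := fun h => by
    obtain ⟨d, rfl⟩ := hq b
    exact hbW (W.lower (le_iterate_dia n _) (h d fun i hi => hi.elim))
  -- Any ultrafilter above `G` lies inside `F`: a member `J` outside `F` would have its complement
  -- in `G`.
  let G : Filter I :=
    { sets := {J | Jᶜ ∉ F}
      univ_sets := by simpa using hempty
      sets_of_superset := fun {J K} hJ hJK hK =>
        hJ (hFmono _ _ (Set.compl_subset_compl.2 hJK) hK)
      inter_sets := fun {J K} hJ hK => by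
        change (J ∩ K)ᶜ ∉ F
        rw [Set.compl_inter]
        exact hFunion _ _ hJ hK }
  have hG : G.NeBot := ⟨fun h => by
    have : ∅ ∈ G := h ▸ Filter.mem_bot
    exact this (by simpa using huniv)⟩
  let U : Ultrafilter I := Ultrafilter.of G
  have hUF : ∀ J ∈ U, J ∈ F := fun J hJ => by
    by_contra hJF
    have : Jᶜ ∈ G := by change Jᶜᶜ ∉ F; rwa [compl_compl]
    exact Ultrafilter.compl_notMem_iff.2 hJ (Ultrafilter.of_le G this)
  let h : KTBHom D (KTBUltrapower U A) := (KTBUltrapower.proj U A).comp e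
  have hP_of : ∀ d, h d = ⊥ → q d ∈ P := fun d hd => by
    have : ∀ᶠ i in (U : Filter I), e d i = ⊥ := Filter.Germ.coe_eq.1 hd
    exact hUF _ this d fun i hi => hi
  -- If `h d ≠ ⊥`, the bound gives `dia^[n] (h d) = ⊤`, so `h` kills the complement of `dia^[n] d`.
  -- Then `W` contains both `dia^[n] (q d)` and its complement, although it is proper.
  have of_hP : ∀ d, q d ∈ P → h d = ⊥ := fun d hd => by
    by_contra hne
    have hev : ∀ᶠ i in (U : Filter I), e d i ≠ ⊥ :=
      Ultrafilter.eventually_not.2 fun h' => hne (Filter.Germ.coe_eq.2 h')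
    have htop : dia^[n] (h d) = ⊤ :=
      (KTBUltrapower.coe_iterate_dia U n (e d)).trans
        (Filter.Germ.coe_eq.2 (hev.mono fun i hi => hn _ hi))
    have := hP_of (dia^[n] d)ᶜ (by rw [h.compl, h.iterate_dia_apply, htop, compl_top])
    rw [q.compl, q.iterate_dia_apply] at this
    have h1 : (dia^[n] (q d))ᶜ ∈ W := W.lower (le_iterate_dia n _) this
    exact hWp.toIsProper.notMem_of_compl_mem h1 hd
  have hfac : ∀ x y, q x = q y → h x = h y := fun x y hxy => by
    have key : ∀ x y, q x = q y → h x ≤ h y := fun x y hxy => by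
      have : h (x ⊓ yᶜ) = ⊥ := of_hP _ (by
        change dia^[n] _ ∈ W
        rw [q.inf, q.compl, hxy, inf_compl_self, iterate_dia_bot]
        exact W.bot_mem)
      rw [h.inf, h.compl] at this
      exact (le_compl_iff_disjoint_right.2 (disjoint_iff.2 this)).trans_eq (compl_compl _)
    exact le_antisymm (key x y hxy) (key y x hxy.symm)
  obtain ⟨f, hf⟩ := q.exists_factor hq h hfac
  refine ⟨I, U, f, fun hfb => ?_⟩
  obtain ⟨d, rfl⟩ := hq b
  rw [hf] at hfb
  exact hbW (W.lower (le_iterate_dia n _) (hP_of d hfb))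

/-- The variety of trivial algebras. -/
def trivialVariety : KTBVariety.{u} where
  mem := {B | Subsingleton B}
  H_subset := by
    rintro B ⟨A, hA, f, hf⟩
    have : Subsingleton A := hA
    exact hf.subsingleton
  S_subset := by
    rintro B ⟨A, hA, f, hf⟩
    have : Subsingleton A := hA
    exact hf.subsingleton
  P_subset := by
    rintro B ⟨I, F, hF, f, hf⟩
    have : ∀ i, Subsingleton (F i) := hF
    exact hf.1.subsingleton

theorem trivialVariety_le (V : KTBVariety.{u}) : trivialVariety ≤ V := fun B hB =>
  have : Subsingleton B := hB
  V.mem_of_subsingleton B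

end KTBVariety

/-! ### Complex algebras of complete graphs -/

namespace CmK

theorem mem_dia {n : ℕ} (X : CmK.{u} n) (v : ULift.{u} (Fin n)) :
    v ∈ (show Set (ULift.{u} (Fin n)) from (dia X : CmK.{u} n)) ↔
      ∃ w, w ∈ (show Set (ULift.{u} (Fin n)) from X) := by
  constructor
  · rintro ⟨w, -, hw⟩
    exact ⟨w, hw⟩
  · rintro ⟨w, hw⟩
    exact ⟨w, (eq_or_ne v w).imp_right (SimpleGraph.top_adj v w).2, hw⟩

theorem dia_eq_top {n : ℕ} {X : CmK.{u} n} (hX : X ≠ ⊥) : dia X = ⊤ := by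
  obtain ⟨w, hw⟩ := Set.nonempty_iff_ne_empty.2 hX
  exact Set.eq_univ_of_forall fun v => (mem_dia X v).2 ⟨w, hw⟩

theorem dia_dia {n : ℕ} (X : CmK.{u} n) : dia (dia X) = dia X := by
  rcases eq_or_ne X ⊥ with rfl | hX
  · rw [dia_bot, dia_bot]
  · rw [dia_eq_top hX, dia_top]

instance (n : ℕ) : Nontrivial (CmK.{u} (n + 1)) :=
  inferInstanceAs (Nontrivial (Set (ULift.{u} (Fin (n + 1)))))

theorem eq_bot_or_eq_top_of_one (X : CmK.{u} 1) : X = ⊥ ∨ X = ⊤ :=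
  (Set.eq_empty_or_nonempty (α := ULift.{u} (Fin 1)) X).imp_right
    Subsingleton.eq_univ_of_nonempty

theorem dia_eq_self_of_one (X : CmK.{u} 1) : dia X = X := by
  rcases eq_bot_or_eq_top_of_one X with rfl | rfl
  exacts [dia_bot, dia_top]

/-- The three sets partition the vertices, and two vertices cannot meet three disjoint sets. -/
theorem eq_bot_of_two (X Y : CmK.{u} 2) : X ⊓ Y = ⊥ ∨ X ⊓ Yᶜ = ⊥ ∨ Xᶜ = ⊥ := by
  by_contra! h
  obtain ⟨⟨⟨a⟩, ha, ha'⟩, ⟨⟨b⟩, hb, hb'⟩, ⟨⟨c⟩, hc⟩⟩ :=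
    And.imp Set.nonempty_iff_ne_empty.2
      (And.imp Set.nonempty_iff_ne_empty.2 Set.nonempty_iff_ne_empty.2) h
  have hab : a ≠ b := by rintro rfl; exact hb' ha'
  have hac : a ≠ c := by rintro rfl; exact hc ha
  have hbc : b ≠ c := by rintro rfl; exact hc hb
  omega

/-- This turns the bound of two atoms into an identity, which passes to the generated variety.
Wherever ◇ sends every nonzero element to `⊤`, it again says that one of three blocks is empty. -/
theorem identity_of_two (X Y : CmK.{u} 2) : dia (X ⊓ Y) ⊓ dia (X ⊓ Yᶜ) ⊓ dia Xᶜ = ⊥ := by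
  rcases eq_bot_of_two X Y with h | h | h <;> simp [h, dia_bot]

theorem one_embeds_two : KTBEmbeds (CmK.{u} 1) (CmK.{u} 2) := by
  let f : KTBHom (CmK.{u} 1) (CmK.{u} 2) :=
    { toFun := fun X => {_v | (show Set (ULift.{u} (Fin 1)) from X) ⟨0⟩}
      map_sup := fun _ _ => rfl
      map_inf := fun _ _ => rfl
      map_compl := fun _ => rfl
      map_bot := rfl
      map_top := rfl
      map_dia := fun X => by
        rw [dia_eq_self_of_one]
        refine Set.ext fun v => Iff.trans ?_ (mem_dia _ v).symm
        exact ⟨fun h => ⟨⟨0⟩, h⟩, fun ⟨_, h⟩ => h⟩ }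
  refine ⟨f, f.injective_of_eq_bot fun X hX => ?_⟩
  refine (eq_bot_or_eq_top_of_one X).resolve_right ?_
  rintro rfl
  rw [f.top] at hX
  exact top_ne_bot hX

theorem exists_dia_ne_self_of_two : ∃ X : CmK.{u} 2, dia X ≠ X := by
  let X : CmK.{u} 2 := ({⟨0⟩} : Set (ULift.{u} (Fin 2)))
  refine ⟨X, fun h => ?_⟩
  have h1 : (⟨1⟩ : ULift.{u} (Fin 2)) ∈ (show Set (ULift.{u} (Fin 2)) from (dia X : CmK.{u} 2)) :=
    (mem_dia X _).2 ⟨⟨0⟩, rfl⟩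
  rw [h] at h1
  have h2 : (⟨1⟩ : ULift.{u} (Fin 2)) = ⟨0⟩ := h1
  simp at h2

end CmK

/-! ### Strictness of the chain -/

namespace KTBVariety

theorem trivialVariety_lt_Var {A : Type u} [KTBAlgebra A] [Nontrivial A] : trivialVariety < Var A :=
  (trivialVariety_le _).lt_of_not_ge fun h =>
    not_subsingleton A (show Subsingleton A from h (self_mem_Var A))

/-- The identity `dia x = x` holds over one vertex and fails for a singleton over two. -/
theorem Var_one_lt_Var_two : Var (CmK.{u} 1) < Var (CmK.{u} 2) := by
  refine (Var_le_iff.2 (mem_of_embeds _ (self_mem_Var _) CmK.one_embeds_two)).lt_of_not_ge ?_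
  intro h
  obtain ⟨X, hX⟩ := CmK.exists_dia_ne_self_of_two.{u}
  exact hX (identity_of_mem_Var (Var_le_iff.1 h) (fun _ _ x _ => dia x) (fun _ _ x _ => x)
    (fun _ _ _ _ f x _ => f.dia_apply x) (fun _ _ _ _ _ _ _ => rfl)
    (fun x _ => CmK.dia_eq_self_of_one x) X X)

/-- `Var (CmK 2)` contains no infinite algebra in which every nonzero element reaches `⊤`. -/
theorem notMem_Var_two {A : Type u} [KTBAlgebra A] [Infinite A]
    (hA : ∀ x : A, x ≠ ⊥ → ∃ n, dia^[n] x = ⊤) : (⟨A⟩ : KTBAlg) ∉ (Var (CmK.{u} 2)).mem := by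
  intro hmem
  have hdd : ∀ x : A, dia (dia x) = dia x := fun x =>
    identity_of_mem_Var hmem (fun _ _ x _ => dia (dia x)) (fun _ _ x _ => dia x)
      (fun _ _ _ _ f x _ => by simp) (fun _ _ _ _ f x _ => by simp)
      (fun x _ => CmK.dia_dia x) x x
  have hdia : ∀ x : A, x ≠ ⊥ → dia x = ⊤ := fun x hx => by
    obtain ⟨n, hn⟩ := hA x hx
    have : dia^[n] (dia x) = dia x := Function.iterate_fixed (hdd x) n
    rw [← this, ← Function.iterate_succ_apply, Function.iterate_succ_apply', hn, dia_top]
  have hid : ∀ x y : A, dia (x ⊓ y) ⊓ dia (x ⊓ yᶜ) ⊓ dia xᶜ = ⊥ :=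
    identity_of_mem_Var hmem (fun _ _ x y => dia (x ⊓ y) ⊓ dia (x ⊓ yᶜ) ⊓ dia xᶜ) (fun _ _ _ _ => ⊥)
      (fun _ _ _ _ f x y => by simp) (fun _ _ _ _ f x y => by simp) CmK.identity_of_two
  -- Every `x` other than `⊥` and `⊤` is thus an atom, and so is its complement. Hence the algebra
  -- has only the four elements listed below.
  have hcases : ∀ x : A, x ≠ ⊤ → ∀ y, x ≤ yᶜ ∨ x ≤ y := fun x hx y => by
    by_contra! h
    have h1 : x ⊓ y ≠ ⊥ := fun h' => h.1 (le_compl_iff_disjoint_right.2 (disjoint_iff.2 h'))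
    have h2 : x ⊓ yᶜ ≠ ⊥ := fun h' =>
      h.2 ((le_compl_iff_disjoint_right.2 (disjoint_iff.2 h')).trans_eq (compl_compl y))
    have h3 : xᶜ ≠ ⊥ := fun h' => hx (compl_eq_bot.1 h')
    have := hid x y
    rw [hdia _ h1, hdia _ h2, hdia _ h3, top_inf_eq, top_inf_eq] at this
    exact hx (eq_top_of_bot_eq_top this.symm x)
  obtain ⟨x, hx⟩ := (Set.toFinite ({⊥, ⊤} : Set A)).infinite_compl.nonempty
  simp only [Set.mem_compl_iff, Set.mem_insert_iff, Set.mem_singleton_iff, not_or] at hx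
  have hx' : xᶜ ≠ ⊤ := fun h => hx.1 (compl_eq_top.1 h)
  refine Set.infinite_univ.not_finite ((Set.toFinite ({⊥, x, xᶜ, ⊤} : Set A)).subset fun y _ => ?_)
  simp only [Set.mem_insert_iff, Set.mem_singleton_iff]
  rcases hcases x hx.2 y with h1 | h1 <;> rcases hcases xᶜ hx' y with h2 | h2
  · exact Or.inl (by
      have : (⊤ : A) ≤ yᶜ := by rw [← sup_compl_eq_top (x := x)]; exact sup_le h1 h2
      exact compl_eq_top.1 (top_le_iff.1 this))
  · exact Or.inr (Or.inr (Or.inl (le_antisymm (le_compl_comm.1 h1) h2)))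
  · exact Or.inr (Or.inl (le_antisymm (compl_le_compl_iff_le.1 h2) h1))
  · exact Or.inr (Or.inr (Or.inr (by
      have : (⊤ : A) ≤ y := by rw [← sup_compl_eq_top (x := x)]; exact sup_le h1 h2
      exact top_le_iff.1 this)))

end KTBVariety

/-! ### Heights and the main theorem -/

theorem Order.height_eq_add_one_of_lt_iff_le {α : Type*} [PartialOrder α] {a b : α}
    (h : ∀ c, c < b ↔ c ≤ a) : Order.height b = Order.height a + 1 := by
  refine le_antisymm ?_ (Order.height_add_one_le ((h a).2 le_rfl))
  rw [Order.height_eq_iSup_lt_height]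
  exact iSup₂_le fun c hc => add_le_add_left (Order.height_mono ((h c).1 hc)) 1

/-- Height is taken in the poset of all varieties of KTB-algebras, where the variety of trivial
algebras has height `0`. -/
theorem mainTheorem4 (A : Type u) [KTBAlgebra A]
    (infinite : Infinite A)
    (embeds : KTBEmbeds (CmK.{u} 2) A)
    (simple : ∀ (I : Type u) (U : Ultrafilter I), KTBIsSimple (KTBUltrapower U A))
    (subalgebras : ∀ (I : Type u) (U : Ultrafilter I) (B : Type u) [KTBAlgebra B],
      KTBEmbeds B (KTBUltrapower U A) →
        KTBIsomorphic B (CmK.{u} 1) ∨ KTBIsomorphic B (CmK.{u} 2) ∨ KTBEmbeds A B) :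
    Order.height (KTBVariety.Var A) = 3 ∧
      KTBVariety.Var (CmK.{u} 2) ⋖ KTBVariety.Var A := by
  open KTBVariety in
  obtain ⟨n, hn⟩ := exists_uniform_iterate_dia simple
  have hlt2 : Var (CmK.{u} 2) < Var A :=
    (Var_le_iff.2 (mem_of_embeds _ (self_mem_Var A) embeds)).lt_of_not_ge fun h =>
      notMem_Var_two (fun x hx => ⟨n, hn x hx⟩) (Var_le_iff.1 h)
  have hlt1 : Var (CmK.{u} 1) < Var (CmK.{u} 2) := Var_one_lt_Var_two
  have hlt0 : trivialVariety < Var (CmK.{u} 1) := trivialVariety_lt_Var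
  -- a separating image of a member of a subvariety
  have image : ∀ V ≤ Var A, ∀ (B : Type u) [KTBAlgebra B], (⟨B⟩ : KTBAlg) ∈ V.mem →
      ∀ b : B, b ≠ ⊥ → (∃ f : KTBHom B (CmK.{u} 1), f b ≠ ⊥ ∧ Function.Surjective f) ∨
        (∃ f : KTBHom B (CmK.{u} 2), f b ≠ ⊥ ∧ Function.Surjective f) ∨
        (⟨A⟩ : KTBAlg) ∈ V.mem := by
    intro V hV B _ hB b hb
    obtain ⟨I, U, f, hf⟩ := exists_hom_ultrapower hn (hV hB) hb
    obtain ⟨S, _, p, i, hp, hi, hip⟩ := f.exists_image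
    have hpb : p b ≠ ⊥ := fun h => hf (by rw [← hip, h, i.bot])
    have lift : ∀ (C : Type u) [KTBAlgebra C], KTBIsomorphic S C →
        ∃ f : KTBHom B C, f b ≠ ⊥ ∧ Function.Surjective f := fun C _ ⟨g, hg⟩ =>
      ⟨g.comp p, fun h => hpb (hg.1 (h.trans g.bot.symm)), hg.2.comp hp⟩
    -- `S` embeds in an ultrapower, so (iv) applies. It is also a quotient of `B`, so in the third
    -- case `A` embeds in a member of `V`.
    rcases subalgebras I U S ⟨i, hi⟩ with h | h | h
    · exact Or.inl (lift _ h)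
    · exact Or.inr (Or.inl (lift _ h))
    · exact Or.inr (Or.inr (V.mem_of_embeds (V.mem_of_surjective hB p hp) h))
  have le2 : ∀ V, V < Var A ↔ V ≤ Var (CmK.{u} 2) := fun V => by
    refine ⟨fun hV => le_Var_of_separating fun B _ hB b hb => ?_, fun h => h.trans_lt hlt2⟩
    rcases image V hV.le B hB b hb with ⟨f, hf, -⟩ | ⟨f, hf, -⟩ | h
    · obtain ⟨g, hg⟩ := CmK.one_embeds_two.{u}
      exact ⟨g.comp f, fun h => hf (hg (h.trans g.bot.symm))⟩
    · exact ⟨f, hf⟩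
    · exact absurd (Var_le_iff.2 h) hV.not_ge
  -- Surjectivity matters here: a map from `B` onto `CmK 2` would put `CmK 2` itself in `V`.
  have le1 : ∀ V, V < Var (CmK.{u} 2) ↔ V ≤ Var (CmK.{u} 1) := fun V => by
    refine ⟨fun hV => le_Var_of_separating fun B _ hB b hb => ?_, fun h => h.trans_lt hlt1⟩
    rcases image V (hV.trans hlt2).le B hB b hb with ⟨f, hf, -⟩ | ⟨f, -, hf⟩ | h
    · exact ⟨f, hf⟩
    · exact absurd (Var_le_iff.2 (V.mem_of_surjective hB f hf)) hV.not_ge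
    · exact absurd (Var_le_iff.2 h) (hV.trans hlt2).not_ge
  have le0 : ∀ V, V < Var (CmK.{u} 1) ↔ V ≤ trivialVariety := fun V => by
    refine ⟨fun hV => ?_, fun h => h.trans_lt hlt0⟩
    rintro ⟨B⟩ hB
    change Subsingleton B
    by_contra hB'
    rw [not_subsingleton_iff_nontrivial] at hB'
    have hV2 := hV.trans hlt1
    -- A nontrivial member has `⊤ ≠ ⊥`, and each possible image would put a generator in `V` that
    -- `V` is too small to contain.
    rcases image V (hV2.trans hlt2).le B hB ⊤ top_ne_bot with ⟨f, -, hf⟩ | ⟨f, -, hf⟩ | h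
    · exact hV.not_ge (Var_le_iff.2 (V.mem_of_surjective hB f hf))
    · exact hV2.not_ge (Var_le_iff.2 (V.mem_of_surjective hB f hf))
    · exact (hV2.trans hlt2).not_ge (Var_le_iff.2 h)
  refine ⟨?_, hlt2, fun V h h' => ((le2 V).1 h').not_gt h⟩
  rw [Order.height_eq_add_one_of_lt_iff_le le2, Order.height_eq_add_one_of_lt_iff_le le1,
    Order.height_eq_add_one_of_lt_iff_le le0,
    Order.height_eq_zero.2 (fun V _ => trivialVariety_le V)]
  rfl
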